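/- A group is hyperbolic if it has a finite symmetric generating set whose Cayley graph is Gromov hyperbolic, that is, there is $\delta\ge 0$ such that in every geodesic triangle each side lies in the closed $\delta$-neighbourhood of the union of the other two. The profinite topology on a group $G$ is the topology whose basic open sets are the cosets of the normal subgroups of finite index of $G$. The group $G$ is conjugacy separable if for every $g\in G$ the conjugacy class $\{h^{-1}gh : h\in G\}$ is closed in the profinite topology on $G$; it is hereditarily conjugacy separable if every subgroup of finite index in $G$ is conjugacy separable; and it is cyclic subgroup separable if for every $g\in G$ the cyclic subgroup $\langle g\rangle$ is closed in the profinite topology on $G$. **Proposition.** Let $G$ be a torsion-free hyperbolic group and let $H$ be a normal subgroup of $G$ (not assumed to be finitely generated). Suppose that $G$ is hereditarily conjugacy separable and that $G/H$ is cyclic subgroup separable. Then the fibre product $$T_H=\{(g_1,g_2)\in G\times G : g_1H=g_2H\}\le G\times G$$ is a conjugacy separable group. -/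

import Mathlib

/-! Hyperbolic groups -/

/-- A graph has `δ`-slim geodesic triangles: for all vertices `x`, `y`, `z` and all geodesic edge
paths `p` from `x` to `y`, `q` from `y` to `z` and `r` from `x` to `z`, every vertex of `p` is at
distance at most `δ` from a vertex of `q` or of `r`. As `x`, `y`, `z` are arbitrary and paths can be
reversed, this covers all three sides of a triangle. (Passing to triangles of the geometric
realization whose corners or points lie inside edges changes `δ` only by an additive constant.) -/
def SimpleGraph.HasSlimTriangles {V : Type*} (Γ : SimpleGraph V) (δ : ℕ) : Prop :=
  ∀ (x y z : V) (p : Γ.Walk x y) (q : Γ.Walk y z) (r : Γ.Walk x z),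
    p.length = Γ.dist x y → q.length = Γ.dist y z → r.length = Γ.dist x z →
      ∀ v ∈ p.support, ∃ w, (w ∈ q.support ∨ w ∈ r.support) ∧ Γ.dist v w ≤ δ

/-- A group is (Gromov) hyperbolic if it has a finite symmetric generating set `A` whose Cayley
graph, with the graph metric, has `δ`-slim geodesic triangles for some `δ`. -/
def IsHyperbolicGroup (G : Type*) [Group G] : Prop :=
  ∃ A : Set G, A.Finite ∧ (∀ a ∈ A, a⁻¹ ∈ A) ∧ Subgroup.closure A = ⊤ ∧
    ∃ δ : ℕ, (SimpleGraph.mulCayley A).HasSlimTriangles δ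

/-- A group is torsion-free if its only element of finite order is `1`. (For non-commutative groups
this is weaker than `IsMulTorsionFree`, which asks for unique roots.) -/
def IsTorsionFreeGroup (G : Type*) [Group G] : Prop :=
  ∀ g : G, IsOfFinOrder g → g = 1

/-! The profinite topology and separability -/

/-- The profinite topology on a group: the topology whose basic open sets are the cosets of the
normal subgroups of finite index. -/
abbrev profiniteTopology (G : Type*) [Group G] : TopologicalSpace G :=
  TopologicalSpace.generateFrom
    {U : Set G | ∃ (N : Subgroup G) (g : G), N.Normal ∧ N.FiniteIndex ∧
      U = {x : G | g⁻¹ * x ∈ N}}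

/-- A subset of a group is separable if it is closed in the profinite topology. -/
def IsSeparableIn {G : Type*} [Group G] (S : Set G) : Prop :=
  @IsClosed G (profiniteTopology G) S

/-- A group is conjugacy separable if all its conjugacy classes are separable. -/
def IsConjugacySeparable (G : Type*) [Group G] : Prop :=
  ∀ g : G, IsSeparableIn {x : G | ∃ h : G, x = h⁻¹ * g * h}

/-- A group is hereditarily conjugacy separable if all its subgroups of finite index are conjugacy
separable. -/
def IsHereditarilyConjugacySeparable (G : Type*) [Group G] : Prop :=
  ∀ K : Subgroup G, K.FiniteIndex → IsConjugacySeparable K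

/-- A group is cyclic subgroup separable if all its cyclic subgroups are separable. -/
def IsCyclicSubgroupSeparable (G : Type*) [Group G] : Prop :=
  ∀ g : G, IsSeparableIn (Subgroup.zpowers g : Set G)

/-! Fibre products -/

/-- The fibre product associated to a normal subgroup `N` of `G`: the subgroup of `G × G` of all
pairs whose two entries have the same image in `G ⧸ N`. -/
def fibreProduct {G : Type*} [Group G] (N : Subgroup G) [N.Normal] : Subgroup (G × G) :=
  ((QuotientGroup.mk' N).comp (MonoidHom.fst G G)).eqLocus
    ((QuotientGroup.mk' N).comp (MonoidHom.snd G G))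

/-! Separable subsets -/

/-! If `x` and `(g₁, g₂)` have non-conjugate entries in some coordinate, a finite quotient of `G`
separates them. Otherwise a diagonal conjugation brings `x` to `(g₁, a⁻¹ g₂ a)`, which is conjugate
to `(g₁, g₂)` in the fibre product exactly when `a ∈ C(g₂) C(g₁) H`.

Suppose it is not. Then `g₁, g₂ ≠ 1`, so by hyperbolicity and torsion-freeness `⟨gᵢ⟩` has finite
index in `C(gᵢ)`. As `g₁` and `g₂` have the same image `q` in `G ⧸ H`, the image of `C(g₂) C(g₁)` is
a finite union of translates `b⟨q⟩c`, hence closed, and some finite-index `L ≥ H` has `a ∉ C(g₂)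
C(g₁) L`. By the centralizer condition, in a deep enough finite quotient whatever commutes with `gᵢ`
lies in `C(gᵢ)` modulo `L`, so a conjugacy there would put `a` in `C(g₂) C(g₁) L`. -/

theorem isOpen_profiniteTopology_iff {G : Type*} [Group G] (U : Set G) :
    @IsOpen G (profiniteTopology G) U ↔
      ∀ x ∈ U, ∃ N : Subgroup G, N.Normal ∧ N.FiniteIndex ∧ ∀ y, x⁻¹ * y ∈ N → y ∈ U := by
  constructor
  · intro h
    induction h with
    | basic s hs =>
      obtain ⟨N, g, hN, hf, rfl⟩ := hs
      refine fun x hx => ⟨N, hN, hf, fun y hy => ?_⟩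
      have := N.mul_mem hx hy
      simpa [mul_assoc] using this
    | univ => exact fun x _ => ⟨⊤, inferInstance, inferInstance, fun y _ => trivial⟩
    | inter s t _ _ hs ht =>
      intro x hx
      obtain ⟨N, hN, hf, h⟩ := hs x hx.1
      obtain ⟨M, hM, hf', h'⟩ := ht x hx.2
      exact ⟨N ⊓ M, inferInstance, inferInstance, fun y hy => ⟨h y hy.1, h' y hy.2⟩⟩
    | sUnion S _ hS =>
      rintro x ⟨s, hs, hx⟩
      obtain ⟨N, hN, hf, h⟩ := hS s hs x hx
      exact ⟨N, hN, hf, fun y hy => ⟨s, hs, h y hy⟩⟩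
  · intro h
    choose! N hN hf hy using h
    have hU : U = ⋃ x ∈ U, {y : G | x⁻¹ * y ∈ N x} := by
      ext y
      simp only [Set.mem_iUnion, Set.mem_ofPred_eq]
      exact ⟨fun h => ⟨y, h, by simp⟩, fun ⟨x, hx, h⟩ => hy x hx y h⟩
    rw [hU]
    let := profiniteTopology G
    exact isOpen_biUnion fun x hx =>
      TopologicalSpace.isOpen_generateFrom_of_mem ⟨N x, x, hN x hx, hf x hx, rfl⟩

theorem isSeparableIn_iff {G : Type*} [Group G] (S : Set G) :
    IsSeparableIn S ↔
      ∀ x ∉ S, ∃ N : Subgroup G, N.Normal ∧ N.FiniteIndex ∧ ∀ y ∈ S, x⁻¹ * y ∉ N := by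
  let := profiniteTopology G
  unfold IsSeparableIn
  rw [← isOpen_compl_iff, isOpen_profiniteTopology_iff]
  refine forall₂_congr fun x _ => exists_congr fun N => and_congr_right fun _ =>
    and_congr_right fun _ => forall_congr' fun y => ?_
  exact imp_not_comm

/-- If cyclic subgroups are separable, then so are finite unions of two-sided translates of a
cyclic subgroup. -/
theorem IsCyclicSubgroupSeparable.exists_finiteIndex {Q : Type*} [Group Q]
    (hQ : IsCyclicSubgroupSeparable Q) (q a : Q) {s t : Set Q} (hs : s.Finite) (ht : t.Finite)
    (ha : ∀ b ∈ s, ∀ c ∈ t, ∀ k : ℤ, a ≠ b * q ^ k * c) :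
    ∃ L : Subgroup Q, L.Normal ∧ L.FiniteIndex ∧
      ∀ b ∈ s, ∀ c ∈ t, ∀ k : ℤ, a⁻¹ * (b * q ^ k * c) ∉ L := by
  have key : ∀ p : s × t, ∃ N : Subgroup Q, N.Normal ∧ N.FiniteIndex ∧
      ∀ k : ℤ, a⁻¹ * ((p.1 : Q) * q ^ k * p.2) ∉ N := by
    rintro ⟨⟨b, hb⟩, ⟨c, hc⟩⟩
    obtain ⟨N, hN, hf, h⟩ := (isSeparableIn_iff _).1 (hQ q) (b⁻¹ * a * c⁻¹) (by
      rintro ⟨k, hk⟩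
      refine ha b hb c hc k ?_
      simp only at hk
      rw [hk]
      group)
    refine ⟨N, hN, hf, fun k hk => h (q ^ k) ⟨k, rfl⟩ ?_⟩
    have := hN.conj_mem _ hk c
    convert this using 1
    simp only
    group
  choose N hN hf h using key
  have := hs.to_subtype
  have := ht.to_subtype
  have := hf
  exact ⟨⨅ p, N p, Subgroup.normal_iInf_normal hN, Subgroup.finiteIndex_iInf hf,
    fun b hb c hc k hk => h ⟨⟨b, hb⟩, ⟨c, hc⟩⟩ k (Subgroup.mem_iInf.1 hk _)⟩

/-- Hereditarily conjugacy separable groups satisfy the centralizer condition. -/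
theorem IsHereditarilyConjugacySeparable.centralizer_condition {G : Type*} [Group G]
    (hG : IsHereditarilyConjugacySeparable G) (g : G) (K : Subgroup G) [K.Normal]
    [K.FiniteIndex] :
    ∃ N : Subgroup G, N.Normal ∧ N.FiniteIndex ∧ N ≤ K ∧
      ∀ x : G, g⁻¹ * (x⁻¹ * g * x) ∈ N → ∃ c, Commute c g ∧ c⁻¹ * x ∈ K := by
  -- One coset `zK` at a time; there are finitely many, so the resulting subgroups can be
  -- intersected.
  have key : ∀ z : G, ∃ N : Subgroup G, N.Normal ∧ N.FiniteIndex ∧ N ≤ K ∧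
      ∀ k ∈ K, (z⁻¹ * g * z)⁻¹ * (k⁻¹ * g * k) ∈ N → ∃ c, Commute c g ∧ c⁻¹ * z ∈ K := by
    intro z
    by_cases hz : ∃ c, Commute c g ∧ c⁻¹ * z ∈ K
    · exact ⟨K, inferInstance, inferInstance, le_rfl, fun _ _ _ => hz⟩
    -- Conjugators in `M = ⟨g⟩K` may be taken in `K`, and `z⁻¹gz = k⁻¹gk` would make `c = zk⁻¹`
    -- centralize `g`. So `z⁻¹gz` is not conjugate to `g` in `M`, which is conjugacy separable.
    set M : Subgroup G := K ⊔ Subgroup.zpowers g with hM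
    have hKM : K ≤ M := le_sup_left
    have hgM : g ∈ M := le_sup_right (a := K) (Subgroup.mem_zpowers g)
    have : M.FiniteIndex := Subgroup.finiteIndex_of_le hKM
    by_cases hzM : z⁻¹ * g * z ∈ M
    · obtain ⟨N, hN, hf, h⟩ := (isSeparableIn_iff _).1 (hG M inferInstance ⟨g, hgM⟩)
        ⟨z⁻¹ * g * z, hzM⟩ (by
          rintro ⟨⟨h, hh⟩, e⟩
          rw [Subtype.ext_iff] at e
          simp only [Subgroup.coe_mul, Subgroup.coe_inv] at e
          rw [hM, sup_comm] at hh
          obtain ⟨y, ⟨n, rfl⟩, k, hk, rfl⟩ := Subgroup.mem_sup_of_normal_right.1 hh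
          refine hz ⟨z * k⁻¹, ?_, ?_⟩
          · have e' : z⁻¹ * g * z = k⁻¹ * g * k := by
              rw [e]
              simp only
              group
            have : z * (z⁻¹ * g * z) * k⁻¹ = z * (k⁻¹ * g * k) * k⁻¹ := by rw [e']
            change z * k⁻¹ * g = g * (z * k⁻¹)
            simpa [mul_assoc] using this.symm
          · simpa using hk)
      have : (N.map M.subtype).FiniteIndex := by
        refine ⟨?_⟩
        rw [Subgroup.index_map_subtype]
        exact mul_ne_zero hf.index_ne_zero Subgroup.FiniteIndex.index_ne_zero
      refine ⟨(N.map M.subtype).normalCore ⊓ K, inferInstance, inferInstance, inf_le_right,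
        fun k hk hkN => ?_⟩
      obtain ⟨w, hw, e⟩ := Subgroup.normalCore_le _ hkN.1
      refine absurd ?_ (h (⟨k, hKM hk⟩⁻¹ * ⟨g, hgM⟩ * ⟨k, hKM hk⟩) ⟨_, rfl⟩)
      have e : (w : G) = (z⁻¹ * g * z)⁻¹ * (k⁻¹ * g * k) := e
      exact (Subtype.ext e : w = (⟨z⁻¹ * g * z, hzM⟩ : M)⁻¹ *
        (⟨k, hKM hk⟩⁻¹ * ⟨g, hgM⟩ * ⟨k, hKM hk⟩)) ▸ hw
    · refine ⟨K, inferInstance, inferInstance, le_rfl, fun k hk hkN => absurd ?_ hzM⟩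
      have h1 : k⁻¹ * g * k ∈ M := M.mul_mem (M.mul_mem (M.inv_mem (hKM hk)) hgM) (hKM hk)
      have := M.mul_mem h1 (M.inv_mem (hKM hkN))
      simpa [mul_assoc] using this
  choose N hN hf hNK h using key
  have hfin : Finite (G ⧸ K) := inferInstance
  refine ⟨⨅ q : G ⧸ K, N q.out, Subgroup.normal_iInf_normal fun q => hN _,
    Subgroup.finiteIndex_iInf fun q => hf _, (iInf_le _ (1 : G ⧸ K)).trans (hNK _),
    fun x hx => ?_⟩
  obtain ⟨k, hk⟩ := QuotientGroup.mk_out_eq_mul K x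
  set z := (QuotientGroup.mk x : G ⧸ K).out with hz
  have hx' : g⁻¹ * (x⁻¹ * g * x) ∈ N z := Subgroup.mem_iInf.1 hx (QuotientGroup.mk x : G ⧸ K)
  obtain ⟨c, hc, hcz⟩ := h z k k.2 (by
    have h1 := (hN z).conj_mem _ ((N z).inv_mem hx') (k : G)⁻¹
    convert h1 using 1
    rw [hk]
    group)
  refine ⟨c, hc, ?_⟩
  have := K.mul_mem hcz (K.inv_mem k.2)
  rwa [hk, mul_assoc, mul_assoc, mul_inv_cancel, mul_one] at this

/-! Cayley graphs -/

namespace SimpleGraph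

theorem Walk.dist_getVert_le {V : Type*} {Γ : SimpleGraph V} (hΓ : Γ.Connected) {x y : V}
    (p : Γ.Walk x y) {i j : ℕ} (hij : i ≤ j) : Γ.dist (p.getVert i) (p.getVert j) ≤ j - i := by
  induction j, hij using Nat.le_induction with
  | base => simp
  | succ j hij ih =>
    have h1 : Γ.dist (p.getVert j) (p.getVert (j + 1)) ≤ 1 := by
      by_cases hj : j < p.length
      · exact (dist_eq_one_iff_adj.2 (p.adj_getVert_succ hj)).le
      · rw [p.getVert_of_length_le (by omega), p.getVert_of_length_le (by omega)]
        simp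
    have := hΓ.dist_triangle (u := p.getVert i) (v := p.getVert j) (w := p.getVert (j + 1))
    omega

theorem Walk.dist_getVert_of_length_eq_dist {V : Type*} {Γ : SimpleGraph V} (hΓ : Γ.Connected)
    {x y : V} (p : Γ.Walk x y) (hp : p.length = Γ.dist x y) {i j : ℕ} (hij : i ≤ j)
    (hj : j ≤ p.length) : Γ.dist (p.getVert i) (p.getVert j) = j - i := by
  have h1 := p.dist_getVert_le hΓ (Nat.zero_le i)
  have h2 := p.dist_getVert_le hΓ hij
  have h3 := p.dist_getVert_le hΓ hj
  have h4 := hΓ.dist_triangle (u := p.getVert 0) (v := p.getVert i) (w := p.getVert p.length)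
  have h5 := hΓ.dist_triangle (u := p.getVert i) (v := p.getVert j) (w := p.getVert p.length)
  rw [p.getVert_zero] at *
  rw [p.getVert_length] at *
  omega

variable {G : Type*} [Group G] {A : Set G}

theorem mulCayley_connected (hA : Subgroup.closure A = ⊤) : (mulCayley A).Connected := by
  have key : ∀ x : G, (mulCayley A).Reachable 1 x := by
    intro x
    have hx : x ∈ Subgroup.closure A := hA ▸ Subgroup.mem_top x
    induction hx using Subgroup.closure_induction_right with
    | one => exact .refl _
    | mul_right x _ y hy ih =>
      refine ih.trans ?_
      by_cases h : x = x * y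
      · rw [← h]
      · exact Adj.reachable ((mulCayley_adj A _ _).2 ⟨h, by simp [hy]⟩)
    | mul_inv_cancel x _ y hy ih =>
      refine ih.trans ?_
      by_cases h : x = x * y⁻¹
      · rw [← h]
      · exact Adj.reachable ((mulCayley_adj A _ _).2 ⟨h, by simp [hy]⟩)
  exact ⟨fun x y => (key x).symm.trans (key y)⟩

/-- Left multiplication as an endomorphism of the Cayley graph. -/
def mulCayleyMulLeft (A : Set G) (h : G) : mulCayley A →g mulCayley A where
  toFun x := h * x
  map_rel' hxy := (mulCayley_adj_mul_iff_right).2 hxy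

/-- The endpoints are left free so that a translate by `g ^ n` can end at `x * g ^ n` when `x`
commutes with `g`. -/
theorem mulCayley_exists_walk_mul_left {x y x' y' : G} (p : (mulCayley A).Walk x y) (h : G)
    (hx : h * x = x') (hy : h * y = y') :
    ∃ p' : (mulCayley A).Walk x' y', p'.length = p.length ∧
      ∀ v ∈ p'.support, ∃ i, h * p.getVert i = v ∧ i ≤ p.length := by
  subst hx hy
  refine ⟨p.map (mulCayleyMulLeft A h), p.length_map _, fun v hv => ?_⟩
  have hv : v ∈ (p.map (mulCayleyMulLeft A h)).support := hv
  rw [Walk.support_map, List.mem_map] at hv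
  obtain ⟨u, hu, rfl⟩ := hv
  obtain ⟨i, rfl, hi⟩ := Walk.mem_support_iff_exists_getVert.1 hu
  exact ⟨i, rfl, hi⟩

theorem mulCayley_dist_mul_left (hA : Subgroup.closure A = ⊤) (h x y : G) :
    (mulCayley A).dist (h * x) (h * y) = (mulCayley A).dist x y := by
  have key : ∀ h x y : G, (mulCayley A).dist (h * x) (h * y) ≤ (mulCayley A).dist x y := by
    intro h x y
    obtain ⟨p, hp⟩ := (mulCayley_connected hA).exists_walk_length_eq_dist x y
    obtain ⟨p', hp', -⟩ := mulCayley_exists_walk_mul_left p h rfl rfl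
    rw [← hp, ← hp']
    exact dist_le p'
  refine le_antisymm (key h x y) ?_
  simpa using key h⁻¹ (h * x) (h * y)

theorem mulCayley_finite_setOf_dist_le (hfin : A.Finite) (hA : Subgroup.closure A = ⊤) (r : ℕ) :
    {x : G | (mulCayley A).dist 1 x ≤ r}.Finite := by
  induction r with
  | zero =>
    refine (Set.finite_singleton (1 : G)).subset fun x hx => ?_
    have := (mulCayley_connected hA).dist_eq_zero_iff.1 (Nat.le_zero.1 hx)
    exact this.symm
  | succ r ih =>
    refine (ih.union (ih.mul (hfin.union hfin.inv))).subset fun x hx => ?_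
    obtain ⟨p, hp⟩ := (mulCayley_connected hA).exists_walk_length_eq_dist 1 x
    by_cases hr : p.length ≤ r
    · exact Or.inl (hp.symm.trans_le hr)
    have hlen : p.length = r + 1 := by
      have : (mulCayley A).dist 1 x ≤ r + 1 := hx
      omega
    refine Or.inr (Set.mem_mul.2 ⟨p.getVert r, ?_, (p.getVert r)⁻¹ * x, ?_, by group⟩)
    · have := p.dist_getVert_le (mulCayley_connected hA) (Nat.zero_le r)
      rwa [p.getVert_zero] at this
    · have := p.adj_getVert_succ (i := r) (by omega)
      rw [← hlen, p.getVert_length, mulCayley_adj] at this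
      simpa using this.2

/-- If `x` centralizes `g` and is a shortest element of `x⟨g⟩`, then `g ^ n` moves the vertices in
the middle part of a geodesic from `1` to `x` by at most `4δ`. -/
theorem HasSlimTriangles.dist_mul_getVert_le {δ : ℕ} (hδ : (mulCayley A).HasSlimTriangles δ)
    (hA : Subgroup.closure A = ⊤) {g x : G} (hgx : Commute x g)
    (hmin : ∀ k : ℤ, (mulCayley A).dist 1 x ≤ (mulCayley A).dist 1 (x * g ^ k))
    (p : (mulCayley A).Walk 1 x) (hp : p.length = (mulCayley A).dist 1 x) (n : ℕ) {t : ℕ}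
    (ht : (mulCayley A).dist 1 (g ^ n) + 2 * δ < t)
    (ht' : (mulCayley A).dist 1 (g ^ n) + δ + t < p.length) :
    (mulCayley A).dist (p.getVert t) (g ^ n * p.getVert t) ≤ 4 * δ := by
  have hΓ := mulCayley_connected hA
  have hleft := mulCayley_dist_mul_left hA
  -- Otherwise a shortcut from `g ^ k` to `x` would give an element of `x⟨g⟩` shorter than `x`.
  have far : ∀ (k : ℤ) {i : ℕ}, i ≤ p.length → i ≤ (mulCayley A).dist (g ^ k) (p.getVert i) := by
    intro k i hi
    have h1 := hΓ.dist_triangle (u := g ^ k) (v := p.getVert i) (w := x)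
    have h2 := p.dist_getVert_le hΓ hi
    rw [p.getVert_length] at h2
    have h3 : (mulCayley A).dist (g ^ k) x = (mulCayley A).dist 1 (x * g ^ (-k)) := by
      rw [← hleft (g ^ (-k)), (hgx.zpow_right (-k)).eq]
      simp
    have := hmin (-k)
    omega
  set m := p.getVert t with hm
  -- `r` is a diagonal of the quadrilateral `1, x, xgⁿ, gⁿ`. Two slim triangles put `m` within `2δ`
  -- of the opposite side `gⁿp`, since `ht` and `ht'` keep it away from the two short sides.
  obtain ⟨r, hr⟩ := hΓ.exists_walk_length_eq_dist 1 (x * g ^ n)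
  obtain ⟨q, hq⟩ := hΓ.exists_walk_length_eq_dist x (x * g ^ n)
  obtain ⟨s, hs⟩ := hΓ.exists_walk_length_eq_dist 1 (g ^ n)
  have on_geodesic : ∀ {a b : G} (w : (mulCayley A).Walk a b) {v : G},
      w.length = (mulCayley A).dist a b → v ∈ w.support →
      (mulCayley A).dist a v ≤ (mulCayley A).dist a b := by
    intro a b w v hw hv
    obtain ⟨i, rfl, hi⟩ := Walk.mem_support_iff_exists_getVert.1 hv
    have := w.dist_getVert_le hΓ (Nat.zero_le i)
    rw [w.getVert_zero] at this
    omega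
  have hmt : (mulCayley A).dist 1 m = t := by
    have := p.dist_getVert_of_length_eq_dist hΓ hp (Nat.zero_le t) (by omega)
    rwa [p.getVert_zero] at this
  have hmx : (mulCayley A).dist m x = p.length - t := by
    have := p.dist_getVert_of_length_eq_dist hΓ hp (show t ≤ p.length by omega) le_rfl
    rwa [p.getVert_length] at this
  obtain ⟨w, hw, hmw⟩ := hδ 1 x (x * g ^ n) p q r hp hq hr m (p.getVert_mem_support t)
  have hw : w ∈ r.support := by
    refine hw.resolve_left fun hw => ?_
    have h1 := on_geodesic q hq hw
    have h2 := hleft x 1 (g ^ n)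
    rw [mul_one] at h2
    have h3 := hΓ.dist_triangle (u := m) (v := w) (w := x)
    rw [dist_comm (u := w)] at h3
    omega
  obtain ⟨p', hp'l, hp's⟩ :=
    mulCayley_exists_walk_mul_left p (g ^ n) (mul_one _) (hgx.pow_right n).symm.eq
  have hp' : p'.length = (mulCayley A).dist (g ^ n) (x * g ^ n) := by
    have := hleft (g ^ n) 1 x
    rw [mul_one, (hgx.pow_right n).symm.eq] at this
    rw [this, ← hp, hp'l]
  obtain ⟨v, hv, hwv⟩ := hδ 1 (x * g ^ n) (g ^ n) r p'.reverse s hr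
    (by rw [Walk.length_reverse, hp', dist_comm]) hs w hw
  have hmv := hΓ.dist_triangle (u := m) (v := w) (w := v)
  have hv : v ∈ p'.reverse.support := by
    refine hv.resolve_right fun hv => ?_
    have h1 := on_geodesic s hs hv
    have h3 := hΓ.dist_triangle (u := 1) (v := v) (w := m)
    rw [dist_comm (u := v)] at h3
    omega
  obtain ⟨i, rfl, hi⟩ := hp's v (by simpa using hv)
  have hi1 : (mulCayley A).dist 1 (p.getVert i) = i := by
    have := p.dist_getVert_of_length_eq_dist hΓ hp (Nat.zero_le i) hi
    rwa [p.getVert_zero] at this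
  -- By `far`, the parameters `i` and `t` differ by at most `2δ`; this adds a second `2δ` to the
  -- bound.
  have e1 : t ≤ i + 2 * δ := by
    have h1 := far n (i := t) (by omega)
    have h2 := hΓ.dist_triangle (u := g ^ n) (v := g ^ n * p.getVert i) (w := m)
    rw [← hm] at h1
    have h3 := hleft (g ^ n) 1 (p.getVert i)
    rw [mul_one] at h3
    rw [zpow_natCast] at h1
    rw [dist_comm (u := g ^ n * p.getVert i)] at h2
    omega
  have e2 : i ≤ t + 2 * δ := by
    have h1 := far (-n) hi
    have h2 := hΓ.dist_triangle (u := 1) (v := m) (w := g ^ n * p.getVert i)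
    have h3 := hleft (g ^ n) (g ^ (-n : ℤ)) (p.getVert i)
    rw [zpow_neg, zpow_natCast, mul_inv_cancel] at h3
    rw [zpow_neg, zpow_natCast] at h1
    omega
  have e3 : (mulCayley A).dist (p.getVert i) m ≤ 2 * δ := by
    rcases le_total i t with h | h
    · have := p.dist_getVert_le hΓ h
      rw [← hm] at this
      omega
    · have := p.dist_getVert_le hΓ h
      rw [← hm] at this
      rw [dist_comm]
      omega
  have h1 := hΓ.dist_triangle (u := m) (v := g ^ n * p.getVert i) (w := g ^ n * m)
  rw [hleft] at h1
  omega

end SimpleGraph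

/-- In a hyperbolic group an infinite cyclic subgroup has finite index in the centralizer of its
generator. -/
theorem IsHyperbolicGroup.exists_finite_centralizer {G : Type*} [Group G]
    (hG : IsHyperbolicGroup G) {g : G} (hg : ¬ IsOfFinOrder g) :
    ∃ F : Set G, F.Finite ∧ (∀ f ∈ F, Commute f g) ∧
      ∀ x, Commute x g → ∃ f ∈ F, ∃ k : ℤ, x = f * g ^ k := by
  obtain ⟨A, hfin, -, hA, δ, hδ⟩ := hG
  set Γ := SimpleGraph.mulCayley A with hΓdef
  have hΓ : Γ.Connected := SimpleGraph.mulCayley_connected hA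
  have hleft := SimpleGraph.mulCayley_dist_mul_left hA
  have hball := SimpleGraph.mulCayley_finite_setOf_dist_le hfin hA
  set N := (hball (4 * δ)).toFinset.card with hN
  set M := (Finset.range (N + 1)).sup fun n => Γ.dist 1 (g ^ n) with hM
  have hMle : ∀ n ∈ Finset.range (N + 1), Γ.dist 1 (g ^ n) ≤ M := fun n hn =>
    Finset.le_sup (f := fun n => Γ.dist 1 (g ^ n)) hn
  have bound : ∀ x, Commute x g → (∀ k : ℤ, Γ.dist 1 x ≤ Γ.dist 1 (x * g ^ k)) →
      Γ.dist 1 x ≤ 2 * M + 3 * δ + 1 := by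
    intro x hx hmin
    by_contra! hlt
    obtain ⟨p, hp⟩ := hΓ.exists_walk_length_eq_dist 1 x
    -- A point far enough from both ends for all `n ≤ N` at once: the `N + 1` conjugates `m⁻¹gⁿm`
    -- fall in a ball with `N` elements, so two powers of `g` coincide.
    set m := p.getVert (M + 2 * δ + 1) with hm
    have hmaps : ∀ n ∈ Finset.range (N + 1), m⁻¹ * g ^ n * m ∈ (hball (4 * δ)).toFinset := by
      intro n hn
      have hMn := hMle n hn
      have h1 := hδ.dist_mul_getVert_le hA hx hmin p hp n (t := M + 2 * δ + 1)
        (by change Γ.dist _ _ + _ < _; omega) (by change Γ.dist _ _ + _ + _ < _; omega)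
      rw [← hm, ← hleft m⁻¹, inv_mul_cancel, ← mul_assoc] at h1
      simpa using h1
    obtain ⟨i, -, j, -, hij, e⟩ :=
      Finset.exists_ne_map_eq_of_card_lt_of_maps_to (by simp [hN]) hmaps
    exact hij (injective_pow_iff_not_isOfFinOrder.2 hg
      (mul_left_cancel (mul_right_cancel e)))
  refine ⟨{x | Γ.dist 1 x ≤ 2 * M + 3 * δ + 1} ∩ {x | Commute x g},
    (hball _).inter_of_left _, fun f hf => hf.2, fun x hx => ?_⟩
  -- Take a shortest representative of `x⟨g⟩`.
  obtain ⟨k, hk⟩ : ∃ k : ℤ, ∀ l : ℤ, Γ.dist 1 (x * g ^ k) ≤ Γ.dist 1 (x * g ^ l) :=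
    ⟨Function.argmin fun k : ℤ => Γ.dist 1 (x * g ^ k),
      fun l => Function.argmin_le (fun k : ℤ => Γ.dist 1 (x * g ^ k)) l⟩
  have hcomm : Commute (x * g ^ k) g := hx.mul_left ((Commute.refl g).zpow_left k)
  refine ⟨x * g ^ k, ⟨bound _ hcomm fun l => ?_, hcomm⟩, -k, by group⟩
  rw [mul_assoc, ← zpow_add]
  exact hk _

/-! ### Conjugacy classes in the fibre product -/

theorem mem_fibreProduct_iff {G : Type*} [Group G] (N : Subgroup G) [N.Normal] (x : G × G) :
    x ∈ fibreProduct N ↔ x.1⁻¹ * x.2 ∈ N :=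
  QuotientGroup.eq

/-- If `a` is not in `C(g₂) C(g₁) H`, then it is not in `C(g₂) C(g₁) L` for some normal subgroup `L`
of finite index containing `H`. -/
theorem exists_finiteIndex_separating_centralizers {G : Type*} [Group G] (H : Subgroup G)
    [H.Normal] (hhyp : IsHyperbolicGroup G) (htf : IsTorsionFreeGroup G)
    (hQ : IsCyclicSubgroupSeparable (G ⧸ H)) {g₁ g₂ a : G} (h₁ : g₁ ≠ 1) (h₂ : g₂ ≠ 1)
    (hg : g₁⁻¹ * g₂ ∈ H)
    (ha : ∀ c₁ c₂, Commute c₁ g₁ → Commute c₂ g₂ → a⁻¹ * (c₂ * c₁) ∉ H) :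
    ∃ L : Subgroup G, L.Normal ∧ L.FiniteIndex ∧ H ≤ L ∧
      ∀ c₁ c₂, Commute c₁ g₁ → Commute c₂ g₂ → a⁻¹ * (c₂ * c₁) ∉ L := by
  obtain ⟨F₁, hF₁, hF₁c, hF₁'⟩ := hhyp.exists_finite_centralizer (mt (htf g₁) h₁)
  obtain ⟨F₂, hF₂, hF₂c, hF₂'⟩ := hhyp.exists_finite_centralizer (mt (htf g₂) h₂)
  have hgq : (g₁ : G ⧸ H) = g₂ := QuotientGroup.eq.2 hg
  obtain ⟨L, hL, hf, h⟩ := hQ.exists_finiteIndex (g₁ : G ⧸ H) (a : G ⧸ H)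
    (hF₂.image (QuotientGroup.mk : G → G ⧸ H)) (hF₁.image (QuotientGroup.mk : G → G ⧸ H)) (by
      rintro _ ⟨f₂, hf₂, rfl⟩ _ ⟨f₁, hf₁, rfl⟩ k e
      refine ha f₁ (f₂ * g₂ ^ k) (hF₁c f₁ hf₁)
        ((hF₂c f₂ hf₂).mul_left ((Commute.refl g₂).zpow_left k)) (QuotientGroup.eq.1 ?_)
      rw [e, hgq]
      rfl)
  have : (L.comap (QuotientGroup.mk' H)).FiniteIndex :=
    ⟨by rw [Subgroup.index_comap_of_surjective _ (QuotientGroup.mk'_surjective H)]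
        exact hf.index_ne_zero⟩
  refine ⟨L.comap (QuotientGroup.mk' H), inferInstance, inferInstance, ?_, ?_⟩
  · intro x hx
    rw [Subgroup.mem_comap, QuotientGroup.mk'_apply, (QuotientGroup.eq_one_iff x).2 hx]
    exact L.one_mem
  · intro c₁ c₂ hc₁ hc₂ hmem
    obtain ⟨f₁, hf₁, k₁, rfl⟩ := hF₁' c₁ hc₁
    obtain ⟨f₂, hf₂, k₂, rfl⟩ := hF₂' c₂ hc₂
    refine h _ ⟨f₂, hf₂, rfl⟩ _ ⟨f₁, hf₁, rfl⟩ (k₂ + k₁) ?_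
    -- Moving `f₁` to the right merges both powers into one power of `q`.
    rw [((hF₁c f₁ hf₁).zpow_right k₁).eq] at hmem
    simpa only [Subgroup.mem_comap, QuotientGroup.mk'_apply, QuotientGroup.mk_mul,
      QuotientGroup.mk_inv, QuotientGroup.mk_zpow, ← hgq, zpow_add, mul_assoc] using hmem

/-- Separation of a pair `(g₁, a⁻¹ g₂ a)` from the conjugacy class of `(g₁, g₂)` in the fibre
product. -/
theorem exists_finiteIndex_separating_pair {G : Type*} [Group G] (H : Subgroup G) [H.Normal]
    (hhyp : IsHyperbolicGroup G) (htf : IsTorsionFreeGroup G)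
    (hG : IsHereditarilyConjugacySeparable G) (hQ : IsCyclicSubgroupSeparable (G ⧸ H))
    {g₁ g₂ a : G} (hg : g₁⁻¹ * g₂ ∈ H)
    (ha : ∀ t₁ t₂ : G, t₁⁻¹ * t₂ ∈ H → t₁⁻¹ * g₁ * t₁ = g₁ → t₂⁻¹ * g₂ * t₂ ≠ a⁻¹ * g₂ * a) :
    ∃ N : Subgroup G, N.Normal ∧ N.FiniteIndex ∧ ∀ t₁ t₂ : G, t₁⁻¹ * t₂ ∈ H →
      g₁⁻¹ * (t₁⁻¹ * g₁ * t₁) ∈ N → (a⁻¹ * g₂ * a)⁻¹ * (t₂⁻¹ * g₂ * t₂) ∉ N := by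
  have h₁ : g₁ ≠ 1 := by
    rintro rfl
    exact ha a a (by simp) (by simp) rfl
  have h₂ : g₂ ≠ 1 := by
    rintro rfl
    exact ha 1 1 (by simp) (by simp) (by simp)
  obtain ⟨L, hL, hLf, hHL, hLa⟩ :=
    exists_finiteIndex_separating_centralizers H hhyp htf hQ h₁ h₂ hg (a := a) (by
      intro c₁ c₂ hc₁ hc₂ hmem
      refine ha c₁ (c₂⁻¹ * a) ?_ ?_ ?_
      · simpa [mul_assoc] using H.inv_mem hmem
      · rw [mul_assoc, ← hc₁.eq, inv_mul_cancel_left]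
      · have := hc₂.eq
        rw [mul_inv_rev, inv_inv, mul_assoc a⁻¹, this]
        group)
  obtain ⟨N₁, hN₁, hf₁, -, hc₁⟩ := hG.centralizer_condition g₁ L
  obtain ⟨N₂, hN₂, hf₂, -, hc₂⟩ := hG.centralizer_condition g₂ L
  refine ⟨N₁ ⊓ N₂, inferInstance, inferInstance, fun t₁ t₂ ht ht₁ ht₂ => ?_⟩
  obtain ⟨c₁, hc₁, hcL₁⟩ := hc₁ t₁ ht₁.1
  obtain ⟨c₂, hc₂, hcL₂⟩ := hc₂ (t₂ * a⁻¹) (by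
    convert hN₂.conj_mem _ ht₂.2 a using 1
    group)
  -- Modulo `L`: `c₁ = t₁ = t₂ = c₂a`, so `a = c₂⁻¹c₁`.
  refine hLa c₁ c₂⁻¹ hc₁ hc₂.inv_left (QuotientGroup.eq.1 ?_)
  have e₁ : (c₁ : G ⧸ L) = t₁ := QuotientGroup.eq.2 hcL₁
  have e₂ : (c₂ : G ⧸ L) = (t₂ * a⁻¹ : G) := QuotientGroup.eq.2 hcL₂
  have e₃ : (t₁ : G ⧸ L) = t₂ := QuotientGroup.eq.2 (hHL ht)
  rw [QuotientGroup.mk_mul, QuotientGroup.mk_inv, e₂, e₁, e₃]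
  simp

theorem IsHereditarilyConjugacySeparable.exists_finiteIndex {G : Type*} [Group G]
    (hG : IsHereditarilyConjugacySeparable G) {g x : G} (hx : ∀ h : G, x ≠ h⁻¹ * g * h) :
    ∃ N : Subgroup G, N.Normal ∧ N.FiniteIndex ∧ ∀ h : G, x⁻¹ * (h⁻¹ * g * h) ∉ N := by
  obtain ⟨N, hN, hf, hs⟩ := (isSeparableIn_iff _).1 (hG ⊤ inferInstance ⟨g, trivial⟩)
    ⟨x, trivial⟩ (fun ⟨h, e⟩ => hx h (congrArg Subtype.val e))
  refine ⟨N.comap (Subgroup.topEquiv.symm : G ≃* (⊤ : Subgroup G)).toMonoidHom, inferInstance,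
    ⟨?_⟩, fun h hmem => hs _ ⟨⟨h, trivial⟩, rfl⟩ hmem⟩
  rw [Subgroup.index_comap_of_surjective _ (MulEquiv.surjective _)]
  exact hf.index_ne_zero

theorem Subgroup.FiniteIndex.comap {G G' : Type*} [Group G] [Group G'] {N : Subgroup G'}
    (hN : N.FiniteIndex) (f : G →* G') : (N.comap f).FiniteIndex :=
  ⟨by
    rw [Subgroup.index_comap]
    exact fun h => hN.index_ne_zero (Subgroup.index_eq_zero_of_relIndex_eq_zero h)⟩

theorem proposition7p4 {G : Type*} [Group G] (H : Subgroup G) [H.Normal]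
    (hhyp : IsHyperbolicGroup G) (htf : IsTorsionFreeGroup G)
    (hG : IsHereditarilyConjugacySeparable G)
    (hQ : IsCyclicSubgroupSeparable (G ⧸ H)) :
    IsConjugacySeparable (fibreProduct H) := by
  rintro ⟨⟨g₁, g₂⟩, hg⟩
  rw [isSeparableIn_iff]
  rintro ⟨⟨x₁, x₂⟩, hxT⟩ hx
  let π₁ : fibreProduct H →* G := (MonoidHom.fst G G).comp (fibreProduct H).subtype
  let π₂ : fibreProduct H →* G := (MonoidHom.snd G G).comp (fibreProduct H).subtype
  by_cases h₁ : ∀ h : G, x₁ ≠ h⁻¹ * g₁ * h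
  · obtain ⟨N, hN, hf, h⟩ := hG.exists_finiteIndex h₁
    refine ⟨N.comap π₁, inferInstance, hf.comap π₁, ?_⟩
    rintro _ ⟨t, rfl⟩ hmem
    exact h t.1.1 hmem
  by_cases h₂ : ∀ h : G, x₂ ≠ h⁻¹ * g₂ * h
  · obtain ⟨N, hN, hf, h⟩ := hG.exists_finiteIndex h₂
    refine ⟨N.comap π₂, inferInstance, hf.comap π₂, ?_⟩
    rintro _ ⟨t, rfl⟩ hmem
    exact h t.1.2 hmem
  push Not at h₁ h₂
  obtain ⟨a₁, rfl⟩ := h₁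
  obtain ⟨a₂, rfl⟩ := h₂
  -- Conjugating by the diagonal element `(a₁, a₁)` reduces to first entry `g₁`, with `a = a₂a₁⁻¹`.
  obtain ⟨N, hN, hf, h⟩ := exists_finiteIndex_separating_pair H hhyp htf hG hQ
    ((mem_fibreProduct_iff H _).1 hg) (a := a₂ * a₁⁻¹) (by
      intro t₁ t₂ ht e₁ e₂
      refine hx ⟨⟨(t₁ * a₁, t₂ * a₁), (mem_fibreProduct_iff H _).2 ?_⟩, ?_⟩
      · convert (inferInstance : H.Normal).conj_mem _ ht a₁⁻¹ using 1
        group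
      · refine Subtype.ext (Prod.ext ?_ ?_)
        · change a₁⁻¹ * g₁ * a₁ = (t₁ * a₁)⁻¹ * g₁ * (t₁ * a₁)
          calc a₁⁻¹ * g₁ * a₁ = a₁⁻¹ * (t₁⁻¹ * g₁ * t₁) * a₁ := by rw [e₁]
            _ = _ := by group
        · change a₂⁻¹ * g₂ * a₂ = (t₂ * a₁)⁻¹ * g₂ * (t₂ * a₁)
          calc a₂⁻¹ * g₂ * a₂ = a₁⁻¹ * ((a₂ * a₁⁻¹)⁻¹ * g₂ * (a₂ * a₁⁻¹)) * a₁ := by group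
            _ = _ := by rw [← e₂]; simp only [mul_inv_rev, mul_assoc])
  have hf₁ := hf.comap π₁
  have hf₂ := hf.comap π₂
  refine ⟨N.comap π₁ ⊓ N.comap π₂, inferInstance, inferInstance, ?_⟩
  rintro _ ⟨⟨⟨t₁, t₂⟩, ht⟩, rfl⟩ ⟨hm₁, hm₂⟩
  have hm₁ : (a₁⁻¹ * g₁ * a₁)⁻¹ * (t₁⁻¹ * g₁ * t₁) ∈ N := hm₁
  have hm₂ : (a₂⁻¹ * g₂ * a₂)⁻¹ * (t₂⁻¹ * g₂ * t₂) ∈ N := hm₂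
  refine h (t₁ * a₁⁻¹) (t₂ * a₁⁻¹) ?_ ?_ ?_
  · convert (inferInstance : H.Normal).conj_mem _ ((mem_fibreProduct_iff H _).1 ht) a₁ using 1
    group
  · convert hN.conj_mem _ hm₁ a₁ using 1
    group
  · convert hN.conj_mem _ hm₂ a₁ using 1
    group
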